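/- For $x\in\frac12\mathbb Z$ let $a_x$ be functions on the unit circle $\mathbb T$, write $(f)_k=\frac1{2\pi}\int_{-\pi}^{\pi}f(e^{ip})e^{-ikp}\,dp$, and let $L(a)$ be the doubly infinite matrix with entries $L_{j,k}(a)=(a_{\frac{j+k}{2}})_{j-k}$, $j,k\in\mathbb Z$; two such families represent the same symbol if they generate the same matrix $L$. Let $V=\bigcup_{0<\rho<1}V_\rho$, where $a\in V_\rho$ means that every $a_x$ has an analytic extension to the annulus $\rho<|z|<\rho^{-1}$ which is bounded there uniformly in $x$; for $a\in V$, $L(a)$ is a bounded operator on $\ell^2(\mathbb Z)$. For $a,b\in V$ the star product is $$(a\star b)_x(z)=\sum_{m\in\mathbb Z}\sum_{n\in\mathbb Z}z^{m+n}\,(a_{x+\frac m2})_n\,(b_{x-\frac n2})_m ,$$ so that $L(a\star b)=L(a)L(b)$. A symbol is a $+$ (respectively $-$) symbol if $L(a)$ is lower (respectively upper) triangular. The star logarithm $\log_\star a$ exists if there are a simple closed curve $C$ strictly surrounding the spectrum of $L(a)$ and a branch of $\log$ holomorphic on an open set containing $C$ and its interior; it is then the symbol with $L(\log_\star a)=\frac1{2\pi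 i}\oint_C\log\zeta\,(\zeta-L(a))^{-1}d\zeta$, $C$ being traversed anticlockwise. Let $a\in V$ have zero star winding number, that is, suppose that, as symbols, $$a=a_+^L\star a_-^L=a_-^R\star a_+^R$$ where $a_\pm^{L},a_\pm^{R}\in V$ are $\pm$ symbols whose star logarithms exist and belong to $V$. Let $T_n(a)=(L_{j,k}(a))_{j,k=1}^n$. Then, for all sufficiently large $n$, the denominator below is nonzero, and $$\lim_{n\to\infty}\frac{\det T_n(a)}{\det T_{n-1}(a)\,(a_{+,n}^L)_0\,(a_{-,n}^L)_0}=1,$$ where $(a_{\pm,n}^L)_0$ is the zeroth Fourier coefficient of $a^L_{\pm}$ at $x=n$. -/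

import Mathlib

open Filter Topology

noncomputable section

/-- A function `a : ½ℤ × 𝕋 → ℂ`, `(x, z) ↦ a_x(z)`. The half-integer `x = n / 2` is encoded by the
integer `n`, so that `a n` is the function `a_{n/2}` on the unit circle. -/
abbrev StarSymbol : Type := ℤ → Circle → ℂ

/-- The Fourier coefficient `(f)_k` of a function on the unit circle. -/
def fourierCoef (f : Circle → ℂ) (k : ℤ) : ℂ :=
  (1 / (2 * (Real.pi : ℂ))) *
    ∫ p in (-Real.pi)..Real.pi, f (Circle.exp p) * Complex.exp (-(Complex.I * (p : ℂ) * (k : ℂ)))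

/-- The entries `L_{j,k}(a) = (a_{(j+k)/2})_{j-k}` of the doubly infinite matrix `L(a)`. -/
def starLaurent (a : StarSymbol) (j k : ℤ) : ℂ :=
  fourierCoef (a (j + k)) (j - k)

/-- Two functions represent the same symbol when they generate the same matrix `L`. -/
def SameSymbol (a b : StarSymbol) : Prop :=
  ∀ j k : ℤ, starLaurent a j k = starLaurent b j k

/-- The class `V_ρ`: every `a_x` extends analytically to the annulus `ρ < |z| < ρ⁻¹`, with a bound
there that is uniform in `x`. -/
def MemVRho (ρ : ℝ) (a : StarSymbol) : Prop :=
  ∃ F : ℤ → ℂ → ℂ,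
    (∀ (n : ℤ) (z : Circle), F n (z : ℂ) = a n z) ∧
    (∀ n : ℤ, DifferentiableOn ℂ (F n) {z : ℂ | ρ < ‖z‖ ∧ ‖z‖ < ρ⁻¹}) ∧
    ∃ M : ℝ, ∀ (n : ℤ) (z : ℂ), ρ < ‖z‖ → ‖z‖ < ρ⁻¹ → ‖F n z‖ ≤ M

/-- The class `V`, the union of the `V_ρ` over `0 < ρ < 1`. -/
def MemV (a : StarSymbol) : Prop :=
  ∃ ρ : ℝ, 0 < ρ ∧ ρ < 1 ∧ MemVRho ρ a

/-- The Moyal star product,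
`(a ⋆ b)_x(z) = ∑_m ∑_n z^(m+n) (a_{x+m/2})_n (b_{x-n/2})_m`; the double series converges absolutely
when both factors are in `V`. -/
def starProd (a b : StarSymbol) : StarSymbol := fun N z =>
  ∑' m : ℤ, ∑' n : ℤ,
    (z : ℂ) ^ (m + n) * (fourierCoef (a (N + m)) n * fourierCoef (b (N - n)) m)

/-- `a` is a `+` symbol: `L(a)` is lower triangular. -/
def IsPlusSymbol (a : StarSymbol) : Prop :=
  ∀ j k : ℤ, j < k → starLaurent a j k = 0

/-- `a` is a `-` symbol: `L(a)` is upper triangular. -/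
def IsMinusSymbol (a : StarSymbol) : Prop :=
  ∀ j k : ℤ, k < j → starLaurent a j k = 0

/-- The Hilbert space `ℓ²(ℤ)`. -/
abbrev EllTwo : Type := lp (fun _ : ℤ => ℂ) 2

/-- The bounded operator `A` on `ℓ²(ℤ)` is the one represented by the matrix `L(a)`. -/
def IsStarLaurentOp (a : StarSymbol) (A : EllTwo →L[ℂ] EllTwo) : Prop :=
  ∀ j k : ℤ, (A (lp.single 2 k (1 : ℂ))) j = starLaurent a j k

/-- A simple closed curve, as a 1-periodic `C¹` map. The velocity may vanish, so piecewise `C¹`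
curves, suitably parametrised, are included. -/
structure IsSimpleClosedCurve (γ : ℝ → ℂ) : Prop where
  contDiff : ContDiff ℝ 1 γ
  periodic : Function.Periodic γ 1
  injOn : Set.InjOn γ (Set.Ico 0 1)

/-- The winding number of a closed curve around a point that is not on it. -/
def windingNum (γ : ℝ → ℂ) (w : ℂ) : ℂ :=
  (1 / (2 * (Real.pi : ℂ) * Complex.I)) * ∫ t in (0 : ℝ)..1, deriv γ t / (γ t - w)

/-- `B = f(A) = (2πi)⁻¹ ∮_C f(ζ) (ζ - A)⁻¹ dζ`, for a simple closed curve `C` that strictly surrounds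
the spectrum of `A` anticlockwise and that lies, together with its interior, in the open set `U` on
which `f` is holomorphic. -/
def IsHolomorphicFunctionOf (f : ℂ → ℂ) (U : Set ℂ) (A B : EllTwo →L[ℂ] EllTwo) : Prop :=
  IsOpen U ∧ DifferentiableOn ℂ f U ∧
  ∃ γ : ℝ → ℂ, IsSimpleClosedCurve γ ∧
    (∀ t : ℝ, γ t ∈ U) ∧
    (∀ w : ℂ, w ∉ Set.range γ → windingNum γ w ≠ 0 → w ∈ U) ∧
    (∀ w ∈ spectrum ℂ A, w ∉ Set.range γ ∧ windingNum γ w = 1) ∧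
    B = (1 / (2 * (Real.pi : ℂ) * Complex.I)) •
      ∫ t in (0 : ℝ)..1, (deriv γ t * f (γ t)) • resolvent A (γ t)

/-- `b` is the star function `f_⋆(a)`, that is, `L(b) = f(L(a))`. -/
def IsStarFunction (f : ℂ → ℂ) (U : Set ℂ) (a b : StarSymbol) : Prop :=
  ∃ A B : EllTwo →L[ℂ] EllTwo,
    IsStarLaurentOp a A ∧ IsStarLaurentOp b B ∧ IsHolomorphicFunctionOf f U A B

/-- `b` is a star logarithm of `a`: the star function of `a` for a holomorphic branch of `log`. -/
def IsStarLog (a b : StarSymbol) : Prop :=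
  ∃ (f : ℂ → ℂ) (U : Set ℂ), (∀ ζ ∈ U, Complex.exp (f ζ) = ζ) ∧ IsStarFunction f U a b

/-- The star logarithm of `a` exists and belongs to `V`. -/
def HasStarLogInV (a : StarSymbol) : Prop :=
  ∃ b : StarSymbol, MemV b ∧ IsStarLog a b

/-- `a = a₊ᴸ ⋆ a₋ᴸ = a₋ᴿ ⋆ a₊ᴿ` is a Wiener-Hopf star factorization of `a ∈ V`; a symbol of `V` has
zero star winding number when it has one. -/
structure IsWienerHopfStarFactorization (a aLp aLm aRm aRp : StarSymbol) : Prop where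
  mem : MemV a
  mem_Lp : MemV aLp
  mem_Lm : MemV aLm
  mem_Rm : MemV aRm
  mem_Rp : MemV aRp
  plus_L : IsPlusSymbol aLp
  minus_L : IsMinusSymbol aLm
  minus_R : IsMinusSymbol aRm
  plus_R : IsPlusSymbol aRp
  log_Lp : HasStarLogInV aLp
  log_Lm : HasStarLogInV aLm
  log_Rm : HasStarLogInV aRm
  log_Rp : HasStarLogInV aRp
  left_eq : SameSymbol a (starProd aLp aLm)
  right_eq : SameSymbol a (starProd aRm aRp)

/-- The `n`-by-`n` star-Toeplitz matrix `T_n(a) = (L_{j,k}(a))`, `1 ≤ j, k ≤ n`. -/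
def starToeplitz (n : ℕ) (a : StarSymbol) : Matrix (Fin n) (Fin n) ℂ :=
  Matrix.of fun j k => starLaurent a ((j : ℤ) + 1) ((k : ℤ) + 1)

/-- `(a_n)_0`, the mean of `a_x` at the integer `x = n`. -/
def diagCoef (a : StarSymbol) (n : ℤ) : ℂ :=
  fourierCoef (a (2 * n)) 0

end

noncomputable section


/-! Let `A = L U = u l` be the operator of `a`, with `L`, `l` lower and `U`, `u` upper triangular;
primes denote inverses. By Cramer's rule `det T_{n-1} / det T_n` is the last diagonal entry of
`T_n⁻¹`, so it is enough that this entry times `L_nn U_nn` tends to 1.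

The logarithms make each factor invertible within its algebra of triangular operators: the contour
surrounds the spectrum but cannot surround `0`, and passing to a closed subalgebra only fills holes
of the spectrum (`isUnit_of_windingNum`). Hence `L'_nn = 1 / L_nn` and `U'_nn = 1 / U_nn`.

Let `r` and `q` project onto `(-∞, n]` and `(-∞, 0]`. Triangularity makes `S_n = r U' r L' r` an
exact inverse of `r A r` in the corner of `r` (`corner_mul_corner_inverse`), and its `(n, n)` entry
is `U'_nn L'_nn`. Cutting `(-∞, n]` down to `[1, n]` adds a Schur complement correction involving
the inverse of `q S_n q` (`schur_complement`). That block tends in norm to `q A⁻¹ q`, which is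
invertible because of the second factorization (`corner_mul_inverse`), so its inverses stay bounded.
The correction also carries row `n` of `L' q`, which tends to `0` (`tendsto_norm_corner_inverse`).
`exists_compression_inverse` combines these facts. -/

theorem IsPreconnected.subset_of_disjoint_frontier {X : Type*} [TopologicalSpace X] {s t : Set X}
    (hs : IsPreconnected s) (hd : Disjoint s (frontier t)) (hne : (s ∩ t).Nonempty) : s ⊆ t := by
  have hcov : s ⊆ interior t ∪ (closure t)ᶜ := by
    intro x hx
    by_cases h1 : x ∈ closure t
    · left
      by_contra h2
      exact Set.disjoint_left.mp hd hx ⟨h1, h2⟩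
    · exact Or.inr h1
  have hdis : Disjoint (interior t) (closure t)ᶜ :=
    Set.disjoint_left.mpr fun x hx hx' => hx' (subset_closure (interior_subset hx))
  obtain ⟨x, hxs, hxt⟩ := hne
  have hxi : x ∈ interior t := (hcov hxs).resolve_right fun h => h (subset_closure hxt)
  exact (hs.subset_left_of_subset_union isOpen_interior isClosed_closure.isOpen_compl hdis hcov
    ⟨x, hxs, hxi⟩).trans interior_subset

/-! ### Winding numbers and invertibility in closed subalgebras -/

section Winding

variable {γ : ℝ → ℂ}

theorem IsSimpleClosedCurve.hasDerivAt (hγ : IsSimpleClosedCurve γ) (t : ℝ) :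
    HasDerivAt γ (deriv γ t) t :=
  (hγ.contDiff.differentiable one_ne_zero t).hasDerivAt

theorem IsSimpleClosedCurve.intervalIntegrable (hγ : IsSimpleClosedCurve γ) {w : ℂ}
    (hw : w ∉ Set.range γ) :
    IntervalIntegrable (fun t => deriv γ t / (γ t - w)) MeasureTheory.volume 0 1 := by
  apply Continuous.intervalIntegrable
  exact (hγ.contDiff.continuous_deriv le_rfl).div (hγ.contDiff.continuous.sub continuous_const)
    fun t h => hw ⟨t, sub_eq_zero.mp h⟩

theorem IsSimpleClosedCurve.eq_endpoints (hγ : IsSimpleClosedCurve γ) : γ 1 = γ 0 := by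
  simpa using hγ.periodic 0

/-- The winding number is the same at the two ends of a segment that does not meet the curve. -/
theorem windingNum_eq_of_segment (hγ : IsSimpleClosedCurve γ) {v w : ℂ}
    (h : ∀ t, γ t ∉ segment ℝ v w) : windingNum γ v = windingNum γ w := by
  have hv : ∀ t, γ t - v ≠ 0 := fun t ht => h t (sub_eq_zero.mp ht ▸ left_mem_segment ℝ v w)
  have hw : ∀ t, γ t - w ≠ 0 := fun t ht => h t (sub_eq_zero.mp ht ▸ right_mem_segment ℝ v w)
  -- The quotient is real and nonpositive only when `γ t` lies on the segment. Off it, the principal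
  -- logarithm is a global primitive of the difference of the two integrands, and the curve is
  -- closed.
  have hslit : ∀ t, (γ t - v) / (γ t - w) ∈ Complex.slitPlane := by
    intro t
    by_contra hns
    obtain ⟨s, hs0, hs⟩ : ∃ s : ℝ, 0 ≤ s ∧ (γ t - v) / (γ t - w) = -(s : ℂ) := by
      rw [Complex.mem_slitPlane_iff, not_or, not_lt, not_not] at hns
      refine ⟨-((γ t - v) / (γ t - w)).re, by linarith [hns.1], ?_⟩
      apply Complex.ext <;> simp [hns.2]
    rw [div_eq_iff (hw t)] at hs
    refine h t ⟨1 / (1 + s), s / (1 + s), by positivity, by positivity, by field_simp, ?_⟩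
    have h1 : (1 + (s : ℂ)) ≠ 0 := by
      exact_mod_cast (by positivity : (1 + s) ≠ 0)
    simp only [Complex.real_smul]
    push_cast
    field_simp
    linear_combination -hs
  have hd : ∀ t, HasDerivAt (fun t => Complex.log ((γ t - v) / (γ t - w)))
      (deriv γ t / (γ t - v) - deriv γ t / (γ t - w)) t := by
    intro t
    have := (((hγ.hasDerivAt t).sub_const v).fun_div
      ((hγ.hasDerivAt t).sub_const w) (hw t)).clog_real (hslit t)
    convert this using 1
    have h1 := hv t
    have h2 := hw t
    field_simp
  have hiv := hγ.intervalIntegrable (w := v) fun ⟨t, ht⟩ => hv t (sub_eq_zero.mpr ht)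
  have hiw := hγ.intervalIntegrable (w := w) fun ⟨t, ht⟩ => hw t (sub_eq_zero.mpr ht)
  have := intervalIntegral.integral_eq_sub_of_hasDerivAt (a := 0) (b := 1) (fun t _ => hd t)
    (hiv.sub hiw)
  rw [intervalIntegral.integral_sub hiv hiw, hγ.eq_endpoints, sub_self, sub_eq_zero] at this
  rw [windingNum, windingNum, this]

/-- The winding number vanishes at a point `p` whose ray `[1, ∞) p` does not meet the curve. -/
theorem windingNum_eq_zero_of_ray (hγ : IsSimpleClosedCurve γ) {p : ℂ} (hp : p ≠ 0)
    (h : ∀ t : ℝ, ∀ s : ℝ, 1 ≤ s → γ t ≠ s * p) : windingNum γ p = 0 := by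
  have hv : ∀ t, γ t - p ≠ 0 := fun t ht => h t 1 le_rfl (by simpa using sub_eq_zero.mp ht)
  have hslit : ∀ t, (p - γ t) / p ∈ Complex.slitPlane := by
    intro t
    by_contra hns
    obtain ⟨s, hs0, hs⟩ : ∃ s : ℝ, 0 ≤ s ∧ (p - γ t) / p = -(s : ℂ) := by
      rw [Complex.mem_slitPlane_iff, not_or, not_lt, not_not] at hns
      refine ⟨-((p - γ t) / p).re, by linarith [hns.1], ?_⟩
      apply Complex.ext <;> simp [hns.2]
    rw [div_eq_iff hp] at hs
    refine h t (1 + s) (by linarith) ?_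
    push_cast
    linear_combination -hs
  have hd : ∀ t, HasDerivAt (fun t => Complex.log ((p - γ t) / p))
      (deriv γ t / (γ t - p)) t := by
    intro t
    have := (((hγ.hasDerivAt t).const_sub p).div_const p).clog_real (hslit t)
    convert this using 1
    have h1 := hv t
    have h2 : p - γ t ≠ 0 := fun h' => h1 (by linear_combination -h')
    field_simp
    ring
  have hiv := hγ.intervalIntegrable (w := p) fun ⟨t, ht⟩ => hv t (sub_eq_zero.mpr ht)
  have := intervalIntegral.integral_eq_sub_of_hasDerivAt (a := 0) (b := 1) (fun t _ => hd t) hiv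
  rw [hγ.eq_endpoints, sub_self] at this
  rw [windingNum, this, mul_zero]

end Winding

/-- If a closed curve surrounds the spectrum of an element `x` of a closed subalgebra `S` but does
not surround `0`, then `x` is invertible in `S`. -/
theorem isUnit_of_windingNum {A : Type*} [NormedRing A] [NormedAlgebra ℂ A] [CompleteSpace A]
    (S : Subalgebra ℂ A) (hS : IsClosed (S : Set A)) (x : S) {γ : ℝ → ℂ}
    (hγ : IsSimpleClosedCurve γ) (hsp : ∀ w ∈ spectrum ℂ (x : A), w ∉ Set.range γ ∧
      windingNum γ w = 1) (h0 : 0 ∉ Set.range γ) (hw0 : windingNum γ 0 = 0) : IsUnit x := by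
  have : IsClosed (S : Set A) := hS
  have : CompleteSpace S := hS.completeSpace_coe
  by_contra hx
  have hz : (0 : ℂ) ∈ spectrum ℂ x := spectrum.zero_mem ℂ hx
  -- Boundary points of the spectrum relative to `S` already belong to the spectrum in `A`, so the
  -- curve avoids them and winds once around each.
  have hfr := Subalgebra.frontier_spectrum (𝕜 := ℂ) S x
  have hcpt : IsCompact (spectrum ℂ x) := spectrum.isCompact x
  have hdisj : Disjoint (Set.range γ) (frontier (spectrum ℂ x)) :=
    Set.disjoint_right.mpr fun w hw => (hsp w (hfr hw)).1
  have hfsub : frontier (spectrum ℂ x) ⊆ spectrum ℂ x := (spectrum.isClosed x).frontier_subset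
  by_cases hmeet : (Set.range γ ∩ spectrum ℂ x).Nonempty
  -- The connected curve now lies inside the relative spectrum. A point of largest modulus there is
  -- a boundary point, yet the outward ray from it misses the curve: winding numbers 1 and 0
  -- collide.
  · have hsub := (isPreconnected_range hγ.contDiff.continuous).subset_of_disjoint_frontier
      hdisj hmeet
    obtain ⟨p, hp, hmax⟩ := hcpt.exists_isMaxOn ⟨0, hz⟩ continuous_norm.continuousOn
    have hmax' : ∀ y ∈ spectrum ℂ x, ‖y‖ ≤ ‖p‖ := fun y hy => hmax hy
    have hp0 : p ≠ 0 := by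
      rintro rfl
      have := hmax' _ (hsub ⟨0, rfl⟩)
      rw [norm_zero, norm_le_zero_iff] at this
      exact h0 ⟨0, this⟩
    have hpf : p ∈ frontier (spectrum ℂ x) := by
      refine ⟨subset_closure hp, fun hint => ?_⟩
      have hc : Tendsto (fun s : ℝ => (s : ℂ) * p) (𝓝[>] 1) (𝓝 p) := by
        have : Continuous fun s : ℝ => (s : ℂ) * p := by fun_prop
        simpa using (this.tendsto 1).mono_left nhdsWithin_le_nhds
      obtain ⟨s, hs, hs1⟩ := ((hc.eventually (mem_interior_iff_mem_nhds.mp hint)).and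
        self_mem_nhdsWithin).exists
      have := hmax' _ hs
      rw [norm_mul, Complex.norm_real, Real.norm_eq_abs, abs_of_pos (by linarith [hs1])] at this
      nlinarith [norm_pos_iff.mpr hp0, hs1]
    obtain ⟨hpγ, hp1⟩ := hsp p (hfr hpf)
    rw [windingNum_eq_zero_of_ray hγ hp0] at hp1
    · exact zero_ne_one hp1
    · intro t s hs hts
      have := hmax' _ (hsub ⟨t, hts⟩)
      rw [norm_mul, Complex.norm_real, Real.norm_eq_abs, abs_of_pos (by linarith)] at this
      have hs1 : s = 1 := le_antisymm (by nlinarith [norm_pos_iff.mpr hp0]) hs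
      exact hpγ ⟨t, by simpa [hs1] using hts⟩
  -- The curve misses the relative spectrum, which contains the segment from `0` to the nearest
  -- boundary point; the winding number is constant along it, but is 0 at one end and 1 at the
  -- other.
  · have hne : (frontier (spectrum ℂ x)).Nonempty := by
      rw [nonempty_frontier_iff]
      exact ⟨⟨0, hz⟩, hcpt.ne_univ⟩
    obtain ⟨p, hp, hmin⟩ := (hcpt.of_isClosed_subset isClosed_frontier hfsub).exists_isMinOn hne
      continuous_norm.continuousOn
    have hball : Metric.ball (0 : ℂ) ‖p‖ ⊆ spectrum ℂ x := by
      rcases eq_or_ne p 0 with rfl | hp0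
      · simp
      · refine (convex_ball (0 : ℂ) ‖p‖).isPreconnected.subset_of_disjoint_frontier ?_
          ⟨0, by simpa using hp0, hz⟩
        refine Set.disjoint_right.mpr fun y hy hyb => ?_
        rw [mem_ball_zero_iff] at hyb
        exact absurd (hmin hy) (not_le.mpr hyb)
    have := windingNum_eq_of_segment hγ (v := 0) (w := p) fun t ht => by
      refine hmeet ⟨γ t, ⟨t, rfl⟩, ?_⟩
      obtain ⟨a, b, ha, hb, hab, hs⟩ := ht
      rcases eq_or_ne p 0 with rfl | hp0
      · exact absurd ⟨t, by simpa using hs.symm⟩ h0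
      rcases ha.eq_or_lt with rfl | ha
      · rw [zero_add] at hab
        subst hab
        have : γ t = p := by simpa using hs.symm
        exact this ▸ hfsub hp
      · apply hball
        rw [mem_ball_zero_iff, ← hs, smul_zero, zero_add, norm_smul, Real.norm_eq_abs,
          abs_of_nonneg hb]
        nlinarith [norm_pos_iff.mpr hp0]
    rw [hw0, (hsp p (hfr hp)).2] at this
    exact zero_ne_one this


/-! ### Fourier coefficients and the star product -/

theorem fourierCoef_eq_circleIntegral {f : Circle → ℂ} {F : ℂ → ℂ} (hF : ∀ z : Circle, F z = f z)
    (k : ℤ) : fourierCoef f k =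
      (2 * (Real.pi : ℂ) * Complex.I)⁻¹ * ∮ z in C(0, 1), (z - 0)⁻¹ • (z ^ (-k) * F z) := by
  have hper : Function.Periodic (fun p : ℝ => f (Circle.exp p) *
      Complex.exp (-(Complex.I * (p : ℂ) * (k : ℂ)))) (2 * Real.pi) := by
    intro p
    have h1 : Circle.exp (p + 2 * Real.pi) = Circle.exp p := Circle.periodic_exp p
    simp only [h1]
    congr 1
    rw [Complex.exp_eq_exp_iff_exists_int]
    exact ⟨-k, by push_cast; ring⟩
  have hshift := hper.intervalIntegral_add_eq (-Real.pi) 0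
  rw [show -Real.pi + 2 * Real.pi = Real.pi by ring, zero_add] at hshift
  rw [fourierCoef, hshift, circleIntegral]
  have : ∀ p : ℝ, deriv (circleMap 0 1) p • ((circleMap 0 1 p - 0)⁻¹ •
      (circleMap 0 1 p ^ (-k) * F (circleMap 0 1 p))) =
      Complex.I * (f (Circle.exp p) * Complex.exp (-(Complex.I * (p : ℂ) * (k : ℂ)))) := by
    intro p
    have h1 : circleMap 0 1 p = Circle.exp p := by simp [circleMap]
    rw [deriv_circleMap, h1, hF, Circle.coe_exp, ← Complex.exp_int_mul]
    rw [show ((-k : ℤ) : ℂ) * (p * Complex.I) = -(Complex.I * p * k) by push_cast; ring]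
    simp only [sub_zero, smul_eq_mul]
    have h2 := Complex.exp_ne_zero (p * Complex.I)
    field_simp
  simp only [this, intervalIntegral.integral_const_mul]
  rw [← mul_assoc, mul_inv, mul_assoc _ _ Complex.I, inv_mul_cancel₀ Complex.I_ne_zero, mul_one,
    one_div]

/-- Cauchy's estimate for the Fourier coefficients of a function that is analytic in an annulus. -/
theorem norm_fourierCoef_le {ρ M R : ℝ} (hρ : 0 < ρ) (hρ1 : ρ < 1) {f : Circle → ℂ} {F : ℂ → ℂ}
    (hF : ∀ z : Circle, F z = f z)
    (hd : DifferentiableOn ℂ F {z : ℂ | ρ < ‖z‖ ∧ ‖z‖ < ρ⁻¹})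
    (hM : ∀ z : ℂ, ρ < ‖z‖ → ‖z‖ < ρ⁻¹ → ‖F z‖ ≤ M) (hR : ρ < R) (hR' : R < ρ⁻¹) (k : ℤ) :
    ‖fourierCoef f k‖ ≤ M * R ^ (-k) := by
  have hR0 : 0 < R := hρ.trans hR
  have h1ρ : 1 < ρ⁻¹ := (one_lt_inv₀ hρ).mpr hρ1
  have hopen : IsOpen {z : ℂ | ρ < ‖z‖ ∧ ‖z‖ < ρ⁻¹} :=
    (isOpen_lt continuous_const continuous_norm).inter (isOpen_lt continuous_norm continuous_const)
  have hG : ∀ z : ℂ, ρ < ‖z‖ → ‖z‖ < ρ⁻¹ → DifferentiableAt ℂ (fun z => z ^ (-k) * F z) z := by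
    intro z h1 h2
    refine DifferentiableAt.mul ?_ (hd.differentiableAt (hopen.mem_nhds ⟨h1, h2⟩))
    exact differentiableAt_zpow.mpr (Or.inl (norm_pos_iff.mp (hρ.trans h1)))
  have key : ∀ r s : ℝ, ρ < r → r ≤ s → s < ρ⁻¹ →
      (∮ z in C(0, s), (z - 0)⁻¹ • (z ^ (-k) * F z)) =
        ∮ z in C(0, r), (z - 0)⁻¹ • (z ^ (-k) * F z) := by
    intro r s hr hrs hs
    refine Complex.circleIntegral_sub_center_inv_smul_eq_of_differentiable_on_annulus_off_countable
      (hρ.trans hr) hrs Set.countable_empty ?_ ?_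
    · intro z hz
      simp only [Set.mem_sdiff, mem_closedBall_zero_iff, mem_ball_zero_iff, not_lt] at hz
      exact (hG z (hr.trans_le hz.2) (hz.1.trans_lt hs)).continuousAt.continuousWithinAt
    · intro z hz
      simp only [Set.mem_sdiff, mem_closedBall_zero_iff, mem_ball_zero_iff, not_le] at hz
      exact hG z (hr.trans hz.1.2) (hz.1.1.trans hs)
  have hshift : (∮ z in C(0, 1), (z - 0)⁻¹ • (z ^ (-k) * F z)) =
      ∮ z in C(0, R), (z - 0)⁻¹ • (z ^ (-k) * F z) := by
    rcases le_total 1 R with h | h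
    · exact (key 1 R hρ1 h hR').symm
    · exact key R 1 hR h h1ρ
  rw [fourierCoef_eq_circleIntegral hF, hshift, ← smul_eq_mul]
  have := circleIntegral.norm_two_pi_i_inv_smul_integral_le_of_norm_le_const (c := 0) (R := R)
    (f := fun z => (z - 0)⁻¹ • (z ^ (-k) * F z)) (C := R⁻¹ * (R ^ (-k) * M)) hR0.le ?_
  · refine this.trans_eq ?_
    field_simp
  · intro z hz
    rw [mem_sphere_zero_iff_norm] at hz
    rw [sub_zero, norm_smul, norm_inv, norm_mul, norm_zpow, hz]
    have := hM z (hz ▸ hR) (hz ▸ hR')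
    gcongr

/-- Cauchy's estimate on the circle of radius `r⁻¹` serves `k ≥ 0`, and on the circle of radius `r`
serves `k ≤ 0`, for any `r` strictly between `ρ` and 1. -/
theorem MemV.exists_decay {a : StarSymbol} (ha : MemV a) :
    ∃ C r : ℝ, 0 ≤ C ∧ 0 < r ∧ r < 1 ∧ ∀ n k : ℤ, ‖fourierCoef (a n) k‖ ≤ C * r ^ k.natAbs := by
  obtain ⟨ρ, hρ, hρ1, F, hF, hd, M, hM⟩ := ha
  obtain ⟨r, hr, hr1⟩ := exists_between hρ1
  have hr0 := hρ.trans hr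
  have h1ρ : 1 < ρ⁻¹ := (one_lt_inv₀ hρ).mpr hρ1
  refine ⟨M, r, (norm_nonneg _).trans (hM 0 1 (by simpa) (by simpa)), hr0, hr1, fun n k => ?_⟩
  rcases le_total 0 k with hk | hk
  · have := norm_fourierCoef_le hρ hρ1 (hF n) (hd n) (hM n) (R := r⁻¹)
      (hρ1.trans ((one_lt_inv₀ hr0).mpr hr1)) (inv_strictAnti₀ hρ hr) k
    rwa [inv_zpow, zpow_neg, inv_inv, show r ^ k = r ^ k.natAbs by
      rw [← zpow_natCast, Int.natAbs_of_nonneg hk]] at this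
  · have := norm_fourierCoef_le hρ hρ1 (hF n) (hd n) (hM n) hr (hr1.trans h1ρ) k
    rwa [← Int.ofNat_natAbs_of_nonpos hk, zpow_natCast] at this

theorem summable_pow_natAbs {r : ℝ} (h0 : 0 < r) (h1 : r < 1) :
    Summable fun k : ℤ => r ^ k.natAbs := by
  apply Summable.of_nat_of_neg <;>
  simpa using summable_geometric_of_lt_one h0.le h1

theorem fourierCoef_zpow (n k : ℤ) :
    fourierCoef (fun z => (z : ℂ) ^ n) k = if n = k then 1 else 0 := by
  have hpi : (Real.pi : ℂ) ≠ 0 := by exact_mod_cast Real.pi_ne_zero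
  have : ∀ p : ℝ, (Circle.exp p : ℂ) ^ n * Complex.exp (-(Complex.I * (p : ℂ) * (k : ℂ))) =
      Complex.exp (((n - k : ℤ) * Complex.I) * p) := by
    intro p
    rw [Circle.coe_exp, ← Complex.exp_int_mul, ← Complex.exp_add]
    congr 1
    push_cast
    ring
  simp only [fourierCoef, this]
  split_ifs with h
  · simp only [h, sub_self, Int.cast_zero, zero_mul, Complex.exp_zero,
      intervalIntegral.integral_const, sub_neg_eq_add, Complex.real_smul, mul_one]
    push_cast
    field_simp
    ring
  · have hnk : ((n - k : ℤ) : ℂ) * Complex.I ≠ 0 :=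
      mul_ne_zero (by exact_mod_cast sub_ne_zero.mpr h) Complex.I_ne_zero
    rw [integral_exp_mul_complex hnk]
    have : Complex.exp (((n - k : ℤ) * Complex.I) * (Real.pi : ℝ)) =
        Complex.exp (((n - k : ℤ) * Complex.I) * (-Real.pi : ℝ)) := by
      rw [Complex.exp_eq_exp_iff_exists_int]
      exact ⟨n - k, by push_cast; ring⟩
    rw [this, sub_self, zero_div, mul_zero]

/-- Fourier coefficients of an absolutely convergent trigonometric series. -/
theorem hasSum_fourierCoef {ι : Type*} [Countable ι] (c : ι → ℂ) (e : ι → ℤ)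
    (hc : Summable fun i => ‖c i‖) (k : ℤ) :
    HasSum (fun i => if e i = k then c i else 0)
      (fourierCoef (fun z => ∑' i, (z : ℂ) ^ (e i) * c i) k) := by
  have h := intervalIntegral.hasSum_integral_of_dominated_convergence (a := -Real.pi)
    (b := Real.pi) (μ := MeasureTheory.volume)
    (F := fun i (p : ℝ) => (Circle.exp p : ℂ) ^ (e i) * c i *
      Complex.exp (-(Complex.I * (p : ℂ) * (k : ℂ))))
    (f := fun p : ℝ => (∑' i, (Circle.exp p : ℂ) ^ (e i) * c i) *
      Complex.exp (-(Complex.I * (p : ℂ) * (k : ℂ))))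
    (fun i _ => ‖c i‖) ?_ ?_ ?_ ?_ ?_
  · have h2 := h.mul_left (1 / (2 * (Real.pi : ℂ)))
    refine h2.congr_fun ?_
    intro i
    have h3 := fourierCoef_zpow (e i) k
    rw [fourierCoef] at h3
    have : ∀ p : ℝ, (Circle.exp p : ℂ) ^ (e i) * c i *
        Complex.exp (-(Complex.I * (p : ℂ) * (k : ℂ))) = c i * ((Circle.exp p : ℂ) ^ (e i) *
        Complex.exp (-(Complex.I * (p : ℂ) * (k : ℂ)))) := fun p => by ring
    simp only [this, intervalIntegral.integral_const_mul]
    rw [mul_left_comm, h3]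
    simp
  · intro i
    have : Continuous fun p : ℝ => (Circle.exp p : ℂ) ^ (e i) * c i *
      Complex.exp (-(Complex.I * (p : ℂ) * (k : ℂ))) := by
      refine Continuous.mul (Continuous.mul (Continuous.zpow₀ ?_ _ ?_) continuous_const) ?_
      · fun_prop
      · exact fun p => Or.inl (Circle.coe_ne_zero _)
      · fun_prop
    exact this.aestronglyMeasurable
  · refine fun i => MeasureTheory.ae_of_all _ fun p _ => ?_
    have : -(Complex.I * (p : ℂ) * (k : ℂ)) = ((-(p * k) : ℝ) : ℂ) * Complex.I := by
      push_cast; ring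
    rw [norm_mul, norm_mul, norm_zpow, Circle.norm_coe, one_zpow, this,
      Complex.norm_exp_ofReal_mul_I]
    simp
  · exact MeasureTheory.ae_of_all _ fun p _ => hc
  · exact intervalIntegrable_const
  · refine MeasureTheory.ae_of_all _ fun p _ => HasSum.mul_right _ (Summable.hasSum ?_)
    apply Summable.of_norm
    simpa using hc

/-- `L(a ⋆ b) = L(a) L(b)`, entry by entry. -/
theorem hasSum_starLaurent_starProd {a b : StarSymbol} (ha : MemV a) (hb : MemV b) (j k : ℤ) :
    HasSum (fun l => starLaurent a j l * starLaurent b l k)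
      (starLaurent (starProd a b) j k) := by
  obtain ⟨C, r, hC, hr0, hr1, ha⟩ := ha.exists_decay
  obtain ⟨D, s, hD, hs0, hs1, hb⟩ := hb.exists_decay
  let c : ℤ × ℤ → ℂ := fun p =>
    fourierCoef (a (j + k + p.1)) p.2 * fourierCoef (b (j + k - p.2)) p.1
  have hc : Summable fun p => ‖c p‖ := by
    have h := ((summable_pow_natAbs hs0 hs1).mul_left D).mul_of_nonneg
      ((summable_pow_natAbs hr0 hr1).mul_left C) (fun _ => by positivity)
      (fun _ => by positivity)
    refine h.of_nonneg_of_le (fun _ => norm_nonneg _) fun p => ?_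
    rw [norm_mul, mul_comm]
    exact mul_le_mul (hb _ _) (ha _ _) (norm_nonneg _) (by positivity)
  have hsum := hasSum_fourierCoef c (fun p => p.1 + p.2) hc (j - k)
  have heq : (fun z : Circle => ∑' i : ℤ × ℤ, (z : ℂ) ^ (i.1 + i.2) * c i) =
      starProd a b (j + k) := by
    funext z
    refine Summable.tsum_prod (f := fun i : ℤ × ℤ => (z : ℂ) ^ (i.1 + i.2) * c i) ?_
    apply Summable.of_norm
    simpa only [norm_mul, norm_zpow, Circle.norm_coe, one_zpow, one_mul] using hc
  rw [heq] at hsum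
  -- Only pairs `(m, n)` with `m + n = j - k` contribute; they are parametrised by the inner index
  -- `l` of the matrix product.
  let φ : ℤ → ℤ × ℤ := fun l => (l - k, j - l)
  have hφ : Function.Injective φ := fun l l' h => by
    simpa [φ] using congrArg Prod.fst h
  rw [← hφ.hasSum_iff] at hsum
  · refine hsum.congr_fun fun l => ?_
    simp only [Function.comp_apply, φ, c, starLaurent]
    rw [if_pos (by ring), show j + k + (l - k) = j + l by ring,
      show j + k - (j - l) = l + k by ring]
  · intro p hp
    refine if_neg fun h => hp ⟨p.1 + k, ?_⟩
    ext <;> simp only [φ] <;> linarith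


/-! ### Operators on `ℓ²(ℤ)` and triangular algebras -/

/-- The standard basis vector `e_k` of `ℓ²(ℤ)`. -/
def stdVec (k : ℤ) : EllTwo := lp.single 2 k (1 : ℂ)

theorem stdVec_apply (k j : ℤ) : stdVec k j = if j = k then 1 else 0 := by
  rw [stdVec, lp.single_apply]
  split_ifs with h
  · subst h; simp
  · simp [h]

theorem norm_stdVec (k : ℤ) : ‖stdVec k‖ = 1 := by
  rw [stdVec, lp.norm_single (by norm_num), norm_one]

theorem hasSum_smul_stdVec (v : EllTwo) : HasSum (fun k => v k • stdVec k) v := by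
  have h := lp.hasSum_single (p := 2) (by norm_num) v
  refine h.congr_fun fun k => ?_
  rw [stdVec, ← lp.single_smul, smul_eq_mul, mul_one]

/-- The `j`-th coordinate functional on `ℓ²(ℤ)`. -/
def coord (j : ℤ) : EllTwo →L[ℂ] ℂ := lp.evalCLM ℂ (fun _ : ℤ => ℂ) 2 j

theorem coord_apply (j : ℤ) (v : EllTwo) : coord j v = v j := rfl

theorem norm_coord_le (j : ℤ) (v : EllTwo) : ‖v j‖ ≤ ‖v‖ :=
  lp.norm_apply_le_norm (by norm_num) v j

theorem hasSum_apply_apply (T : EllTwo →L[ℂ] EllTwo) (v : EllTwo) (j : ℤ) :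
    HasSum (fun l => T (stdVec l) j * v l) (T v j) := by
  have h := ((coord j).comp T).hasSum (hasSum_smul_stdVec v)
  refine h.congr_fun fun l => ?_
  simp [coord_apply, mul_comm]

theorem ext_stdVec {S T : EllTwo →L[ℂ] EllTwo} (h : ∀ j k, S (stdVec k) j = T (stdVec k) j) :
    S = T := by
  ext v j
  refine (hasSum_apply_apply S v j).unique ?_
  simpa only [h] using hasSum_apply_apply T v j

open Classical in
/-- The coordinate projection of `ℓ²(ℤ)` onto the vectors supported in `s`. -/
def coordProj (s : Set ℤ) : EllTwo →L[ℂ] EllTwo :=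
  LinearMap.mkContinuous
    { toFun := fun v => ⟨fun j => if j ∈ s then v j else 0,
        (lp.memℓp v).norm.mono fun j => by split_ifs <;> simp⟩
      map_add' := fun u v => by
        ext j
        change (if j ∈ s then u j + v j else 0) =
          (if j ∈ s then u j else 0) + if j ∈ s then v j else 0
        by_cases h : j ∈ s <;> simp [h]
      map_smul' := fun c v => by
        ext j
        by_cases h : j ∈ s <;> simp [h] } 1 fun v => by
    rw [one_mul]
    refine lp.norm_mono (by norm_num) fun j => ?_
    by_cases h : j ∈ s <;> simp [h]

open Classical in
theorem coordProj_apply (s : Set ℤ) (v : EllTwo) (j : ℤ) :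
    coordProj s v j = if j ∈ s then v j else 0 := rfl

theorem norm_coordProj_le (s : Set ℤ) : ‖coordProj s‖ ≤ 1 :=
  LinearMap.mkContinuous_norm_le _ zero_le_one _

theorem norm_coordProj_apply_le (s : Set ℤ) (v : EllTwo) : ‖coordProj s v‖ ≤ ‖v‖ := by
  simpa using (coordProj s).le_of_opNorm_le (norm_coordProj_le s) v

theorem coordProj_mul (s t : Set ℤ) : coordProj s * coordProj t = coordProj (s ∩ t) := by
  ext v j
  by_cases hs : j ∈ s <;> by_cases ht : j ∈ t <;>
    simp [coordProj_apply, hs, ht]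

theorem one_sub_coordProj (s : Set ℤ) : 1 - coordProj s = coordProj sᶜ := by
  ext v j
  by_cases hs : j ∈ s <;> simp [coordProj_apply, hs]

theorem coordProj_stdVec {s : Set ℤ} {k : ℤ} (hk : k ∈ s) : coordProj s (stdVec k) = stdVec k := by
  ext j
  rw [coordProj_apply, stdVec_apply]
  split_ifs with h1 h2 h3 <;> simp_all

/-- The algebra of the operators that leave every subspace `V i` invariant. -/
def invariantSubalgebra {ι : Type*} (V : ι → Set ℤ) :
    Subalgebra ℂ (EllTwo →L[ℂ] EllTwo) where
  carrier := {T | ∀ i, ∀ v : EllTwo, (∀ j ∉ V i, v j = 0) → ∀ j ∉ V i, T v j = 0}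
  mul_mem' := fun hS hT i v hv => hS i _ (hT i v hv)
  add_mem' := fun hS hT i v hv j hj => by
    simp [hS i v hv j hj, hT i v hv j hj]
  algebraMap_mem' := fun c i v hv j hj => by
    simp [Algebra.algebraMap_eq_smul_one, hv j hj]

theorem mem_invariantSubalgebra {ι : Type*} {V : ι → Set ℤ} {T : EllTwo →L[ℂ] EllTwo} :
    T ∈ invariantSubalgebra V ↔
      ∀ i, ∀ v : EllTwo, (∀ j ∉ V i, v j = 0) → ∀ j ∉ V i, T v j = 0 := Iff.rfl

/-- Closedness is what allows the boundary of the spectrum relative to the subalgebra to be compared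
with the full spectrum. -/
theorem isClosed_invariantSubalgebra {ι : Type*} (V : ι → Set ℤ) :
    IsClosed (invariantSubalgebra V : Set (EllTwo →L[ℂ] EllTwo)) := by
  have : (invariantSubalgebra V : Set (EllTwo →L[ℂ] EllTwo)) =
      ⋂ (i) (v : EllTwo) (_ : ∀ j ∉ V i, v j = 0) (j) (_ : j ∉ V i),
        {T | coord j (T v) = 0} := by
    ext T
    simp [mem_invariantSubalgebra, coord_apply]
  rw [this]
  refine isClosed_iInter fun i => isClosed_iInter fun v => isClosed_iInter fun _ =>
    isClosed_iInter fun j => isClosed_iInter fun _ => isClosed_eq ?_ continuous_const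
  fun_prop

theorem mem_invariantSubalgebra_of_stdVec {ι : Type*} {V : ι → Set ℤ} {T : EllTwo →L[ℂ] EllTwo}
    (h : ∀ i, ∀ k ∈ V i, ∀ j ∉ V i, T (stdVec k) j = 0) : T ∈ invariantSubalgebra V := by
  intro i v hv j hj
  refine (hasSum_apply_apply T v j).unique ?_
  convert hasSum_zero with k
  by_cases hk : k ∈ V i
  · rw [h i k hk j hj, zero_mul]
  · rw [hv k hk, mul_zero]

theorem apply_stdVec_of_mem {ι : Type*} {V : ι → Set ℤ} {T : EllTwo →L[ℂ] EllTwo}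
    (hT : T ∈ invariantSubalgebra V) {i : ι} {j k : ℤ} (hk : k ∈ V i) (hj : j ∉ V i) :
    T (stdVec k) j = 0 := by
  refine hT i _ (fun l hl => ?_) j hj
  rw [stdVec_apply, if_neg]
  rintro rfl
  exact hl hk

theorem coordProj_compl_mul_mul {ι : Type*} {V : ι → Set ℤ} {T : EllTwo →L[ℂ] EllTwo}
    (hT : T ∈ invariantSubalgebra V) (i : ι) :
    coordProj (V i)ᶜ * T * coordProj (V i) = 0 := by
  ext v j
  simp only [mul_apply_eq_comp, coordProj_apply]
  split_ifs with hj
  · exact hT i _ (fun l hl => by rw [coordProj_apply, if_neg hl]) j hj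
  · rfl

/-- Bounded operators on `ℓ²(ℤ)` with lower triangular matrix. -/
def lowerTriangular : Subalgebra ℂ (EllTwo →L[ℂ] EllTwo) := invariantSubalgebra Set.Ici

/-- Bounded operators on `ℓ²(ℤ)` with upper triangular matrix. -/
def upperTriangular : Subalgebra ℂ (EllTwo →L[ℂ] EllTwo) := invariantSubalgebra Set.Iic

theorem IsStarLaurentOp.mem_lowerTriangular {a : StarSymbol} {A : EllTwo →L[ℂ] EllTwo}
    (hA : IsStarLaurentOp a A) (ha : IsPlusSymbol a) : A ∈ lowerTriangular :=
  mem_invariantSubalgebra_of_stdVec fun _ k hk j hj =>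
    (hA j k).trans (ha j k ((not_le.mp hj).trans_le hk))

theorem IsStarLaurentOp.mem_upperTriangular {a : StarSymbol} {A : EllTwo →L[ℂ] EllTwo}
    (hA : IsStarLaurentOp a A) (ha : IsMinusSymbol a) : A ∈ upperTriangular :=
  mem_invariantSubalgebra_of_stdVec fun _ k hk j hj =>
    (hA j k).trans (ha j k (lt_of_le_of_lt hk (not_le.mp hj)))

/-- An element of a closed subalgebra that has a logarithm given by the Cauchy integral is
invertible in that subalgebra. -/
theorem isUnit_of_isHolomorphicFunctionOf_log (S : Subalgebra ℂ (EllTwo →L[ℂ] EllTwo))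
    (hS : IsClosed (S : Set (EllTwo →L[ℂ] EllTwo))) (x : S) {f : ℂ → ℂ} {U : Set ℂ}
    {B : EllTwo →L[ℂ] EllTwo} (hf : ∀ ζ ∈ U, Complex.exp (f ζ) = ζ)
    (h : IsHolomorphicFunctionOf f U x B) : IsUnit x := by
  obtain ⟨-, -, γ, hγ, hγU, hint, hsp, -⟩ := h
  have h0U : (0 : ℂ) ∉ U := fun h0 => Complex.exp_ne_zero _ (hf 0 h0)
  have h0 : (0 : ℂ) ∉ Set.range γ := by
    rintro ⟨t, ht⟩
    exact h0U (ht ▸ hγU t)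
  exact isUnit_of_windingNum S hS x hγ hsp h0 (by_contra fun hw => h0U (hint 0 h0 hw))

/-- With `S` a triangular algebra, this provides an inverse that is again triangular, which bounded
invertibility alone would not. -/
theorem HasStarLogInV.exists_inverse {a : StarSymbol} (ha : HasStarLogInV a)
    {S : Subalgebra ℂ (EllTwo →L[ℂ] EllTwo)} (hS : IsClosed (S : Set (EllTwo →L[ℂ] EllTwo)))
    (hmem : ∀ A, IsStarLaurentOp a A → A ∈ S) :
    ∃ A ∈ S, ∃ A' ∈ S, IsStarLaurentOp a A ∧ A * A' = 1 ∧ A' * A = 1 := by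
  obtain ⟨b, -, f, U, hf, A, B, hA, -, hAB⟩ := ha
  obtain ⟨u, hu⟩ := isUnit_of_isHolomorphicFunctionOf_log S hS ⟨A, hmem A hA⟩ hf hAB
  have hu' : ((u : S) : EllTwo →L[ℂ] EllTwo) = A := by rw [hu]
  refine ⟨A, hmem A hA, (↑u⁻¹ : S), Subtype.property _, hA, ?_, ?_⟩
  · rw [← hu']
    exact congrArg Subtype.val u.mul_inv
  · rw [← hu']
    exact congrArg Subtype.val u.inv_mul

theorem IsStarLaurentOp.mul {a b : StarSymbol} {A B : EllTwo →L[ℂ] EllTwo} (ha : MemV a)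
    (hb : MemV b) (hA : IsStarLaurentOp a A) (hB : IsStarLaurentOp b B) :
    IsStarLaurentOp (starProd a b) (A * B) := by
  intro j k
  refine (hasSum_apply_apply A (B (stdVec k)) j).unique ?_
  refine (hasSum_starLaurent_starProd ha hb j k).congr_fun fun l => ?_
  rw [← hA j l, ← hB l k]
  rfl


/-! ### Decay of far off-diagonal blocks -/

theorem tendsto_coordProj_Ioi_apply (v : EllTwo) :
    Tendsto (fun n : ℕ => ‖coordProj (Set.Ioi (n : ℤ)) v‖) atTop (𝓝 0) := by
  rw [Metric.tendsto_atTop]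
  intro ε hε
  obtain ⟨s, hs⟩ := ((hasSum_smul_stdVec v).eventually (Metric.ball_mem_nhds v hε)).exists
  obtain ⟨N, hN⟩ := (s : Set ℤ).toFinite.bddAbove
  refine ⟨N.toNat, fun n hn => ?_⟩
  rw [dist_zero_right, norm_norm]
  have h0 : coordProj (Set.Ioi (n : ℤ)) (∑ k ∈ s, v k • stdVec k) = 0 := by
    rw [map_sum]
    refine Finset.sum_eq_zero fun k hk => ?_
    have hkN : k ≤ N := hN hk
    ext j
    rw [map_smul, lp.coeFn_smul, Pi.smul_apply, coordProj_apply, stdVec_apply]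
    split_ifs with h1 h2
    · have : (n : ℤ) < j := h1
      omega
    · simp
    · simp
  calc ‖coordProj (Set.Ioi (n : ℤ)) v‖
      = ‖coordProj (Set.Ioi (n : ℤ)) (v - ∑ k ∈ s, v k • stdVec k)‖ := by
        rw [map_sub, h0, sub_zero]
    _ ≤ ‖v - ∑ k ∈ s, v k • stdVec k‖ := norm_coordProj_apply_le _ _
    _ < ε := by rwa [← dist_eq_norm, dist_comm]

theorem opNorm_le_tsum_stdVec (T : EllTwo →L[ℂ] EllTwo) (h : Summable fun k => ‖T (stdVec k)‖) :
    ‖T‖ ≤ ∑' k, ‖T (stdVec k)‖ := by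
  refine T.opNorm_le_bound (tsum_nonneg fun _ => norm_nonneg _) fun v => ?_
  have h1 : HasSum (fun k => v k • T (stdVec k)) (T v) := by
    simpa using T.hasSum (hasSum_smul_stdVec v)
  have h2 := h.mul_left ‖v‖
  rw [← h1.tsum_eq, mul_comm, ← tsum_mul_left]
  refine tsum_of_norm_bounded h2.hasSum fun k => ?_
  rw [norm_smul]
  exact mul_le_mul_of_nonneg_right (norm_coord_le k v) (norm_nonneg _)

/-- Each column has a vanishing tail; dominated convergence over the columns turns this into norm
convergence. -/
theorem tendsto_coordProj_Ioi_mul (T : EllTwo →L[ℂ] EllTwo)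
    (h : Summable fun k => ‖T (stdVec k)‖) :
    Tendsto (fun n : ℕ => ‖coordProj (Set.Ioi (n : ℤ)) * T‖) atTop (𝓝 0) := by
  have hle : ∀ (n : ℕ) k, ‖(coordProj (Set.Ioi (n : ℤ)) * T) (stdVec k)‖ ≤ ‖T (stdVec k)‖ :=
    fun n k => norm_coordProj_apply_le _ _
  have ht := tendsto_tsum_of_dominated_convergence (𝓕 := atTop)
    (f := fun (n : ℕ) k => ‖(coordProj (Set.Ioi (n : ℤ)) * T) (stdVec k)‖) (g := fun _ => 0) h
    (fun k => tendsto_coordProj_Ioi_apply (T (stdVec k)))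
    (Eventually.of_forall fun n k => by rw [norm_norm]; exact hle n k)
  rw [tsum_zero] at ht
  exact squeeze_zero (fun _ => norm_nonneg _) (fun n => opNorm_le_tsum_stdVec _
    (h.of_nonneg_of_le (fun _ => norm_nonneg _) (hle n))) ht

theorem norm_le_tsum_coord (v : EllTwo) {g : ℤ → ℝ} (hg : Summable g) (h : ∀ j, ‖v j‖ ≤ g j) :
    ‖v‖ ≤ ∑' j, g j := by
  have := tsum_of_norm_bounded (f := fun j => v j • stdVec j) hg.hasSum fun j => by
    rw [norm_smul, norm_stdVec, mul_one]
    exact h j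
  rwa [(hasSum_smul_stdVec v).tsum_eq] at this

/-- The corner of an exponentially decaying matrix has summable column norms. -/
theorem summable_corner {a : StarSymbol} (ha : MemV a) {A : EllTwo →L[ℂ] EllTwo}
    (hA : IsStarLaurentOp a A) : Summable fun k =>
      ‖(coordProj (Set.Ici 1) * A * coordProj (Set.Iic 0)) (stdVec k)‖ := by
  obtain ⟨C, r, hC, hr0, hr1, hdec⟩ := ha.exists_decay
  have hr := summable_pow_natAbs hr0 hr1
  refine (hr.mul_left (C * ∑' j : ℤ, r ^ j.natAbs)).of_nonneg_of_le
    (fun _ => norm_nonneg _) fun k => ?_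
  have : C * (∑' j : ℤ, r ^ j.natAbs) * r ^ k.natAbs =
      ∑' j : ℤ, C * r ^ k.natAbs * r ^ j.natAbs := by
    rw [tsum_mul_left]; ring
  rw [this]
  refine norm_le_tsum_coord _ (hr.mul_left _) fun j => ?_
  simp only [mul_apply_eq_comp, coordProj_apply]
  split_ifs with hj
  · by_cases hk : k ∈ Set.Iic (0 : ℤ)
    · rw [coordProj_stdVec hk]
      have h1 : A (stdVec k) j = starLaurent a j k := hA j k
      rw [h1, starLaurent]
      refine (hdec _ _).trans_eq ?_
      have hk' : k ≤ 0 := hk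
      have hj' : 1 ≤ j := hj
      -- As `k ≤ 0 < j`, the distance to the diagonal splits as `|k| + |j|`, so the bound factors.
      rw [show (j - k).natAbs = k.natAbs + j.natAbs by omega, pow_add, mul_assoc]
    · have : coordProj (Set.Iic 0) (stdVec k) = 0 := by
        ext l
        rw [coordProj_apply, stdVec_apply]
        split_ifs with h1 h2
        · exact absurd (h2 ▸ h1) hk
        · rfl
        · rfl
      rw [this, map_zero]
      simp only [lp.coeFn_zero, Pi.zero_apply, norm_zero]
      positivity
  · rw [norm_zero]
    positivity

theorem coordProj_Ici_one : coordProj (Set.Ici 1) = 1 - coordProj (Set.Iic 0) := by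
  rw [one_sub_coordProj]
  congr 1
  ext j
  simp only [Set.mem_Ici, Set.mem_compl_iff, Set.mem_Iic]
  omega

theorem coordProj_Ioi (n : ℤ) : coordProj (Set.Ioi n) = 1 - coordProj (Set.Iic n) := by
  rw [one_sub_coordProj, Set.compl_Iic]

theorem coordProj_mul_of_subset {s t : Set ℤ} (h : s ⊆ t) :
    coordProj s * coordProj t = coordProj s := by
  rw [coordProj_mul, Set.inter_eq_left.mpr h]

theorem coordProj_mul_of_superset {s t : Set ℤ} (h : s ⊆ t) :
    coordProj t * coordProj s = coordProj s := by
  rw [coordProj_mul, Set.inter_eq_right.mpr h]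

theorem coordProj_Iic_mul_mul {T : EllTwo →L[ℂ] EllTwo} (hT : T ∈ lowerTriangular) (n : ℤ) :
    coordProj (Set.Iic n) * T * (1 - coordProj (Set.Iic n)) = 0 := by
  have := coordProj_compl_mul_mul hT (n + 1)
  rwa [show (Set.Ici (n + 1))ᶜ = Set.Iic n by ext; simp,
    show Set.Ici (n + 1) = (Set.Iic n)ᶜ by ext; simp, ← one_sub_coordProj] at this

theorem mul_coordProj_Iic {T : EllTwo →L[ℂ] EllTwo} (hT : T ∈ upperTriangular) (n : ℤ) :
    (1 - coordProj (Set.Iic n)) * T * coordProj (Set.Iic n) = 0 := by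
  have := coordProj_compl_mul_mul hT n
  rwa [← one_sub_coordProj] at this

/-- The inverse of an exponentially decaying lower triangular matrix has small far off-diagonal
blocks. -/
theorem tendsto_norm_corner_inverse {a : StarSymbol} (ha : MemV a) {A B : EllTwo →L[ℂ] EllTwo}
    (hA : IsStarLaurentOp a A) (hAl : A ∈ lowerTriangular) (hBA : B * A = 1)
    (hAB : A * B = 1) : Tendsto (fun n : ℕ =>
      ‖coordProj (Set.Ioi (n : ℤ)) * B * coordProj (Set.Iic 0)‖) atTop (𝓝 0) := by
  have hs := summable_corner ha hA
  set q := coordProj (Set.Iic 0) with hq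
  rw [coordProj_Ici_one, ← hq] at hs
  have hs' : Summable fun k => ‖(B * ((1 - q) * A * q)) (stdVec k)‖ :=
    (hs.mul_left ‖B‖).of_nonneg_of_le (fun _ => norm_nonneg _) fun k => B.le_opNorm _
  have hqq : q * q = q := coordProj_mul_of_subset subset_rfl
  have hA0 : q * A * (1 - q) = 0 := coordProj_Iic_mul_mul hAl 0
  -- The corner of `B` is expressed through that of `A`, so no entrywise decay of the inverse is
  -- needed: the tail projection already makes `B * ((1 - q) * A * q)` small.
  have hkey : (1 - q) * B * q = -(B * ((1 - q) * A * q)) * (B * q) := by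
    have h1 : q * A * q = q * A := by
      rw [mul_sub, mul_one, sub_eq_zero] at hA0
      exact hA0.symm
    have h2 : q * A * q * B * q = q := by
      rw [h1, mul_assoc q, hAB, mul_one, hqq]
    calc (1 - q) * B * q = B * q - q * B * q := by noncomm_ring
      _ = B * (q * A * q * B * q) - (B * A) * q * B * q := by rw [h2, hBA, one_mul]
      _ = -(B * ((1 - q) * A * q)) * (B * q) := by noncomm_ring
  have hT := (tendsto_coordProj_Ioi_mul _ hs').mul_const ‖B * q‖
  rw [zero_mul] at hT
  refine squeeze_zero (fun _ => norm_nonneg _) (fun n => ?_) hT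
  have h3 : coordProj (Set.Ioi (n : ℤ)) * (1 - q) = coordProj (Set.Ioi (n : ℤ)) := by
    rw [hq, ← coordProj_Ici_one]
    refine coordProj_mul_of_subset fun j hj => ?_
    rw [Set.mem_Ioi] at hj
    rw [Set.mem_Ici]
    omega
  calc ‖coordProj (Set.Ioi (n : ℤ)) * B * q‖
      = ‖-(coordProj (Set.Ioi (n : ℤ)) * (B * ((1 - q) * A * q)) * (B * q))‖ := by
        rw [← h3, mul_assoc _ (1 - q) B, mul_assoc _ _ q, hkey, h3]
        noncomm_ring
    _ ≤ _ := by
        rw [norm_neg]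
        exact norm_mul_le _ _

/-! ### Finite sections and Cramer's rule -/

/-- The compression of an operator on `ℓ²(ℤ)` to the span of `e_1, …, e_n`. -/
def compression (n : ℕ) (T : EllTwo →L[ℂ] EllTwo) : Matrix (Fin n) (Fin n) ℂ :=
  Matrix.of fun j k => T (stdVec ((k : ℤ) + 1)) ((j : ℤ) + 1)

theorem IsStarLaurentOp.compression_eq {a : StarSymbol} {A : EllTwo →L[ℂ] EllTwo}
    (hA : IsStarLaurentOp a A) (n : ℕ) : compression n A = starToeplitz n a := by
  ext j k
  exact hA _ _

theorem compression_mul (n : ℕ) (S T : EllTwo →L[ℂ] EllTwo) :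
    compression n S * compression n T =
      compression n (S * coordProj (Set.Icc 1 (n : ℤ)) * T) := by
  ext j k
  rw [Matrix.mul_apply]
  have h := hasSum_apply_apply S (coordProj (Set.Icc 1 (n : ℤ)) (T (stdVec ((k : ℤ) + 1))))
    ((j : ℤ) + 1)
  let φ : Fin n → ℤ := fun l => (l : ℤ) + 1
  have hφ : Function.Injective φ := fun l l' h => by
    simpa [φ, Fin.ext_iff] using h
  rw [← hφ.hasSum_iff] at h
  · refine (hasSum_fintype _).unique (h.congr_fun fun l => ?_)
    have : (l : ℤ) + 1 ∈ Set.Icc 1 (n : ℤ) := by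
      have := l.isLt
      constructor <;> omega
    simp only [Function.comp_apply, φ]
    rw [coordProj_apply, if_pos this]
    rfl
  · intro l hl
    rw [coordProj_apply, if_neg, mul_zero]
    rintro ⟨h1, h2⟩
    refine hl ⟨⟨(l - 1).toNat, by omega⟩, ?_⟩
    simp only [φ]
    omega

theorem compression_coordProj_mul (n : ℕ) (T : EllTwo →L[ℂ] EllTwo) :
    compression n (coordProj (Set.Icc 1 (n : ℤ)) * T) = compression n T := by
  ext j k
  simp [compression, coordProj_apply]

theorem compression_coordProj (n : ℕ) : compression n (coordProj (Set.Icc 1 (n : ℤ))) = 1 := by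
  rw [← mul_one (coordProj _), compression_coordProj_mul]
  ext j k
  simp [compression, stdVec_apply, Matrix.one_apply, Fin.ext_iff]

theorem compression_submatrix (m : ℕ) (T : EllTwo →L[ℂ] EllTwo) :
    (compression (m + 1) T).submatrix (Fin.last m).succAbove (Fin.last m).succAbove =
      compression m T := by
  ext j k
  simp [compression]

/-- Cramer's rule for the last diagonal entry of the inverse. -/
theorem det_compression_of_mul_eq_one {m : ℕ} {S T : EllTwo →L[ℂ] EllTwo}
    (h : compression (m + 1) S * compression (m + 1) T = 1) :
    (compression m S).det =
      (compression (m + 1) S).det * T (stdVec ((m : ℤ) + 1)) ((m : ℤ) + 1) := by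
  have h1 : (compression (m + 1) S).adjugate =
      (compression (m + 1) S).det • compression (m + 1) T := by
    calc _ = (compression (m + 1) S).adjugate *
          (compression (m + 1) S * compression (m + 1) T) := by rw [h, mul_one]
      _ = _ := by rw [← mul_assoc, Matrix.adjugate_mul, smul_mul_assoc, one_mul]
  have h2 := congrFun (congrFun h1 (Fin.last m)) (Fin.last m)
  rw [Matrix.adjugate_fin_succ_eq_det_submatrix, compression_submatrix, ← two_mul, pow_mul,
    neg_one_sq, one_pow, one_mul] at h2
  rw [h2]
  simp [compression]


/-! ### Corner identities and the Schur complement -/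

section Ring

variable {R : Type*} [Ring R]

/-- The corner of a product of a lower and an upper triangular element is invertible. -/
theorem corner_mul_inverse {q l l' u u' : R} (hq : q * q = q) (hl : l' * l = 1) (hl' : l * l' = 1)
    (hu : u' * u = 1) (hu' : u * u' = 1) (h1 : q * l * (1 - q) = 0) (h1' : q * l' * (1 - q) = 0)
    (h2 : (1 - q) * u * q = 0) (h2' : (1 - q) * u' * q = 0) :
    (q * (l' * u') * q + (1 - q)) * (q * u * q * l * q + (1 - q)) = 1 ∧
    (q * u * q * l * q + (1 - q)) * (q * (l' * u') * q + (1 - q)) = 1 := by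
  have e1 : q * l * q = q * l := by rw [mul_sub, mul_one, sub_eq_zero] at h1; exact h1.symm
  have e1' : q * l' * q = q * l' := by rw [mul_sub, mul_one, sub_eq_zero] at h1'; exact h1'.symm
  have e2 : q * u * q = u * q := by
    rw [sub_mul, one_mul, sub_mul, sub_eq_zero] at h2; exact h2.symm
  have e2' : q * u' * q = u' * q := by
    rw [sub_mul, one_mul, sub_mul, sub_eq_zero] at h2'; exact h2'.symm
  have k1 : q * (l' * u') * q * (q * u * q * l * q) = q :=
    calc _ = q * l' * u' * (q * q) * u * q * l * q := by noncomm_ring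
      _ = q * l' * u' * (q * u * q) * l * q := by rw [hq]; noncomm_ring
      _ = q * l' * (u' * u) * q * l * q := by rw [e2]; noncomm_ring
      _ = (q * l' * q) * l * q := by rw [hu, mul_one]
      _ = q * (l' * l) * q := by rw [e1']; noncomm_ring
      _ = q := by rw [hl, mul_one, hq]
  have k2 : q * u * q * l * q * (q * (l' * u') * q) = q :=
    calc _ = q * u * (q * l * (q * q)) * l' * u' * q := by noncomm_ring
      _ = q * u * q * (l * l') * u' * q := by rw [hq, e1]; noncomm_ring
      _ = q * u * (q * u' * q) := by rw [hl']; noncomm_ring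
      _ = q * (u * u') * q := by rw [e2']; noncomm_ring
      _ = q := by rw [hu', mul_one, hq]
  have z1 : q * (1 - q) = 0 := by rw [mul_sub, mul_one, hq, sub_self]
  have z2 : (1 - q) * q = 0 := by rw [sub_mul, one_mul, hq, sub_self]
  have z3 : (1 - q) * (1 - q) = 1 - q := by rw [mul_sub, z2, mul_one, sub_zero]
  constructor
  · calc _ = q * (l' * u') * q * (q * u * q * l * q) + q * (l' * u') * (q * (1 - q)) +
          (1 - q) * q * (u * q * l * q) + (1 - q) * (1 - q) := by noncomm_ring
      _ = 1 := by rw [k1, z1, z2, z3]; noncomm_ring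
  · calc _ = q * u * q * l * q * (q * (l' * u') * q) + q * u * q * l * (q * (1 - q)) +
          (1 - q) * q * (l' * u' * q) + (1 - q) * (1 - q) := by noncomm_ring
      _ = 1 := by rw [k2, z1, z2, z3]; noncomm_ring

/-- `r u' r l' r` inverts `r l u r` in the corner of `r`. -/
theorem corner_mul_corner_inverse {r l l' u u' : R} (hr : r * r = r) (hl : l * l' = 1)
    (hu : u * u' = 1) (h1 : r * l * (1 - r) = 0) (h2' : (1 - r) * u' * r = 0) :
    r * (l * u) * r * (r * u' * r * l' * r) = r := by
  have e1 : r * l * r = r * l := by rw [mul_sub, mul_one, sub_eq_zero] at h1; exact h1.symm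
  have e2' : r * u' * r = u' * r := by
    rw [sub_mul, one_mul, sub_mul, sub_eq_zero] at h2'; exact h2'.symm
  calc _ = r * l * u * (r * r) * u' * r * l' * r := by noncomm_ring
    _ = r * l * u * (r * u' * r) * l' * r := by rw [hr]; noncomm_ring
    _ = r * l * (u * u') * r * l' * r := by rw [e2']; noncomm_ring
    _ = (r * l * r) * l' * r := by rw [hu, mul_one]
    _ = r * (l * l') * r := by rw [e1]; noncomm_ring
    _ = r := by rw [hl, mul_one, hr]

/-- The inverse of a compression `p A p`, `p = 1 - q`, by a Schur complement in the inverse `S` of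
`A` in the corner of `r`. -/
theorem schur_complement {q r A S E : R} (hq : q * q = q) (hrq : r * q = q)
    (hS : r * A * r * S = r) (hE : (q * S * q + (1 - q)) * E = 1) :
    (1 - q) * (r * A * r) * (1 - q) *
      ((1 - q) * S * (1 - q) - (1 - q) * S * q * E * q * S * (1 - q)) = (1 - q) * r := by
  have z2 : (1 - q) * q = 0 := by rw [sub_mul, one_mul, hq, sub_self]
  have z1 : q * (1 - q) = 0 := by rw [mul_sub, mul_one, hq, sub_self]
  -- Adding `1 - q` made the corner `q S q` invertible in the whole ring; multiplying by `q`
  -- recovers its inverse in the corner.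
  have hqE : q * S * q * E = q :=
    calc q * S * q * E = q * ((q * S * q + (1 - q)) * E) + (q - q * q) * S * q * E -
          q * (1 - q) * E := by noncomm_ring
      _ = q := by rw [hE, hq, z1]; noncomm_ring
  have z3 : (1 - q) * (1 - q) = 1 - q := by rw [mul_sub, z2, mul_one, sub_zero]
  calc _ = (1 - q) * (r * A * r) * ((1 - q) * (1 - q)) * S * (1 - q)
        - (1 - q) * (r * A * r) * ((1 - q) * (1 - q)) * S * q * E * q * S * (1 - q) := by noncomm_ring
    _ = (1 - q) * (r * A * r * S) * (1 - q) - (1 - q) * (r * A * r) * q * S * (1 - q)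
        - (1 - q) * (r * A * r * S) * q * E * q * S * (1 - q)
        + (1 - q) * (r * A * r) * (q * S * q * E) * q * S * (1 - q) := by
      rw [z3]; noncomm_ring
    _ = (1 - q) * r - (1 - q) * (r * q) - (1 - q) * (r * A * r) * q * S * (1 - q)
        - (1 - q) * (r * q) * E * q * S * (1 - q)
        + (1 - q) * (r * A * r) * (q * q) * S * (1 - q) := by
      rw [hS, hqE]; noncomm_ring
    _ = (1 - q) * r := by rw [hrq, z2, hq]; noncomm_ring

end Ring

/-! ### The last diagonal entry of the inverse sections -/

theorem diag_mul_of_triangular {S T : EllTwo →L[ℂ] EllTwo} {n : ℤ}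
    (h : ∀ l, l ≠ n → S (stdVec l) n * T (stdVec n) l = 0) :
    (S * T) (stdVec n) n = S (stdVec n) n * T (stdVec n) n :=
  (hasSum_apply_apply S (T (stdVec n)) n).unique (hasSum_single n h)

theorem lowerTriangular_apply {T : EllTwo →L[ℂ] EllTwo} (hT : T ∈ lowerTriangular) {j k : ℤ}
    (h : j < k) : T (stdVec k) j = 0 :=
  apply_stdVec_of_mem hT (i := k) Set.self_mem_Ici (not_le.mpr h)

theorem upperTriangular_apply {T : EllTwo →L[ℂ] EllTwo} (hT : T ∈ upperTriangular) {j k : ℤ}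
    (h : k < j) : T (stdVec k) j = 0 :=
  apply_stdVec_of_mem hT (i := k) Set.self_mem_Iic (not_le.mpr h)

theorem diag_mul_lowerTriangular {S T : EllTwo →L[ℂ] EllTwo} (hS : S ∈ lowerTriangular)
    (hT : T ∈ lowerTriangular) (n : ℤ) :
    (S * T) (stdVec n) n = S (stdVec n) n * T (stdVec n) n := by
  refine diag_mul_of_triangular fun l hl => ?_
  rcases hl.lt_or_gt with h | h
  · rw [lowerTriangular_apply hT h, mul_zero]
  · rw [lowerTriangular_apply hS h, zero_mul]

theorem diag_mul_upperTriangular {S T : EllTwo →L[ℂ] EllTwo} (hS : S ∈ upperTriangular)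
    (hT : T ∈ upperTriangular) (n : ℤ) :
    (S * T) (stdVec n) n = S (stdVec n) n * T (stdVec n) n := by
  refine diag_mul_of_triangular fun l hl => ?_
  rcases hl.lt_or_gt with h | h
  · rw [upperTriangular_apply hS h, zero_mul]
  · rw [upperTriangular_apply hT h, mul_zero]

theorem norm_apply_stdVec_le (T : EllTwo →L[ℂ] EllTwo) (j k : ℤ) : ‖T (stdVec k) j‖ ≤ ‖T‖ := by
  refine (norm_coord_le j _).trans ((T.le_opNorm _).trans_eq ?_)
  rw [norm_stdVec, mul_one]

/-- The last row of an upper triangular matrix, compressed to `(-∞, n]`. -/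
theorem upperTriangular_apply_of_support {U : EllTwo →L[ℂ] EllTwo} (hU : U ∈ upperTriangular)
    {n : ℤ} {v : EllTwo} (hv : ∀ j, n < j → v j = 0) : U v n = U (stdVec n) n * v n := by
  refine (hasSum_apply_apply U v n).unique (hasSum_single n fun l hl => ?_)
  rcases hl.lt_or_gt with h | h
  · rw [upperTriangular_apply hU h, zero_mul]
  · rw [hv l h, mul_zero]

/-- The inverses of the compressions to `[1, n]`, given by Schur complements. -/
theorem exists_compression_inverse {a : StarSymbol} (ha : MemV a)
    {L L' U U' l l' u u' : EllTwo →L[ℂ] EllTwo} (hLa : IsStarLaurentOp a L)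
    (hL : L ∈ lowerTriangular) (hU' : U' ∈ upperTriangular)
    (hLL : L * L' = 1) (hLL' : L' * L = 1) (hUU : U * U' = 1) (hUU' : U' * U = 1)
    (hl : l ∈ lowerTriangular) (hl' : l' ∈ lowerTriangular)
    (hu : u ∈ upperTriangular) (hu' : u' ∈ upperTriangular)
    (hll : l * l' = 1) (hll' : l' * l = 1) (huu : u * u' = 1) (huu' : u' * u = 1)
    (heq : L * U = u * l) :
    ∃ X : ℕ → EllTwo →L[ℂ] EllTwo,
      (∀ᶠ n : ℕ in atTop, compression n (L * U) * compression n (X n) = 1) ∧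
      Tendsto (fun n : ℕ => X n (stdVec n) n -
        U' (stdVec n) n * L' (stdVec n) n) atTop (𝓝 0) := by
  set q := coordProj (Set.Iic 0) with hq
  set r : ℕ → EllTwo →L[ℂ] EllTwo := fun n => coordProj (Set.Iic (n : ℤ)) with hr
  have hqq : q * q = q := coordProj_mul_of_subset subset_rfl
  have hrr : ∀ n, r n * r n = r n := fun n => coordProj_mul_of_subset subset_rfl
  have hsub : ∀ n : ℕ, Set.Iic (0 : ℤ) ⊆ Set.Iic (n : ℤ) := fun n =>
    Set.Iic_subset_Iic.mpr (by positivity)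
  have hqr : ∀ n, q * r n = q := fun n => coordProj_mul_of_subset (hsub n)
  have hrq : ∀ n, r n * q = q := fun n => coordProj_mul_of_superset (hsub n)
  -- Both products are the inverse of `L * U = u * l`. The form `l' * u'` gives invertibility of the
  -- corner at `q`.
  have hinv : U' * L' = l' * u' :=
    calc U' * L' = U' * L' * ((u * l) * (l' * u')) := by
          rw [mul_assoc u, ← mul_assoc l, hll, one_mul, huu, mul_one]
      _ = U' * (L' * L) * U * (l' * u') := by rw [← heq]; noncomm_ring
      _ = l' * u' := by rw [hLL', mul_one, hUU', one_mul]
  have hcorner : Tendsto (fun n => ‖(1 - r n) * L' * q‖) atTop (𝓝 0) := by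
    simpa only [coordProj_Ioi] using tendsto_norm_corner_inverse ha hLa hL hLL' hLL
  let S : ℕ → EllTwo →L[ℂ] EllTwo := fun n => r n * U' * r n * L' * r n
  let W : EllTwo →L[ℂ] EllTwo := q * (U' * L') * q + (1 - q)
  obtain ⟨hW1, hW2⟩ := corner_mul_inverse hqq hll' hll huu' huu (coordProj_Iic_mul_mul hl 0)
    (coordProj_Iic_mul_mul hl' 0) (mul_coordProj_Iic hu 0) (mul_coordProj_Iic hu' 0)
  rw [← hinv] at hW1 hW2
  have hWu : IsUnit W := ⟨⟨W, _, hW1, hW2⟩, rfl⟩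
  let Wn : ℕ → EllTwo →L[ℂ] EllTwo := fun n => q * S n * q + (1 - q)
  have hWn : Tendsto Wn atTop (𝓝 W) := by
    rw [tendsto_iff_norm_sub_tendsto_zero]
    have h1 := hcorner.const_mul ‖q * U'‖
    rw [mul_zero] at h1
    refine squeeze_zero (fun _ => norm_nonneg _) (fun n => ?_) h1
    -- Since `q r = r q = q`, the only change from `W` is the middle `r n`, whose defect is a far
    -- corner of `L'`.
    have : Wn n - W = -(q * U' * ((1 - r n) * L' * q)) :=
      calc Wn n - W = (q * r n) * U' * r n * L' * (r n * q) - q * (U' * L') * q := by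
            simp only [Wn, W, S]; noncomm_ring
        _ = _ := by rw [hqr, hrq]; noncomm_ring
    rw [this, norm_neg]
    exact norm_mul_le _ _
  obtain ⟨w, hw⟩ := hWu
  have hE : Tendsto (fun n => Ring.inverse (Wn n)) atTop (𝓝 (Ring.inverse W)) := by
    rw [← hw] at hWn ⊢
    exact (NormedRing.inverse_continuousAt w).tendsto.comp hWn
  have hunit : ∀ᶠ n in atTop, IsUnit (Wn n) :=
    hWn.eventually (Units.isOpen.mem_nhds ⟨w, hw⟩)
  let E : ℕ → EllTwo →L[ℂ] EllTwo := fun n => Ring.inverse (Wn n)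
  let X : ℕ → EllTwo →L[ℂ] EllTwo := fun n =>
    (1 - q) * S n * (1 - q) - (1 - q) * S n * q * E n * q * S n * (1 - q)
  have hpr : ∀ n : ℕ, coordProj (Set.Icc 1 (n : ℤ)) = (1 - q) * r n := fun n => by
    rw [hq, ← coordProj_Ici_one, hr, coordProj_mul, Set.Ici_inter_Iic]
  have hrp : ∀ n : ℕ, coordProj (Set.Icc 1 (n : ℤ)) = r n * (1 - q) := fun n => by
    rw [hpr, sub_mul, mul_sub, one_mul, mul_one, hqr, hrq]
  refine ⟨X, ?_, ?_⟩
  · filter_upwards [hunit] with n hn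
    have hX := schur_complement hqq (hrq n)
      (corner_mul_corner_inverse (hrr n) hLL hUU (coordProj_Iic_mul_mul hL n)
        (mul_coordProj_Iic hU' n)) (Ring.mul_inverse_cancel _ hn)
    rw [compression_mul, ← compression_coordProj_mul]
    have : coordProj (Set.Icc 1 (n : ℤ)) *
        (L * U * coordProj (Set.Icc 1 (n : ℤ)) * X n) =
        (1 - q) * (r n * (L * U) * r n) * (1 - q) * X n := by
      nth_rw 1 [hpr]
      rw [hrp]
      noncomm_ring
    rw [this, hX, ← hpr, compression_coordProj]
  -- After compression to `(-∞, n]`, row `n` of the upper triangular `U'` has just its diagonal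
  -- entry.
  · have hrowS : ∀ (n : ℕ) (v : EllTwo), S n v n =
        U' (stdVec n) n * (L' (r n v)) n := by
      intro n v
      have h1 : S n v n = U' (r n (L' (r n v))) n := by
        change r n (U' (r n (L' (r n v)))) n = _
        rw [hr, coordProj_apply, if_pos Set.self_mem_Iic]
      rw [h1, upperTriangular_apply_of_support hU']
      · rw [hr, coordProj_apply (j := (n : ℤ)), if_pos Set.self_mem_Iic]
      · intro j hj
        rw [hr, coordProj_apply, if_neg (show j ∉ Set.Iic (n : ℤ) from not_le.mpr hj)]
    have hSn : ∀ n, ‖S n‖ ≤ ‖U'‖ * ‖L'‖ := by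
      intro n
      have h1 : ‖r n‖ ≤ 1 := norm_coordProj_le _
      calc ‖S n‖ ≤ ‖r n‖ * ‖U'‖ * ‖r n‖ * ‖L'‖ * ‖r n‖ := by
            refine (norm_mul_le _ _).trans ?_
            gcongr
            refine (norm_mul_le _ _).trans ?_
            gcongr
            refine (norm_mul_le _ _).trans ?_
            gcongr
            exact norm_mul_le _ _
        _ ≤ 1 * ‖U'‖ * 1 * ‖L'‖ * 1 := by gcongr
        _ = _ := by ring
    have hqn : ‖q‖ ≤ 1 := norm_coordProj_le _
    have hpn : ∀ n : ℕ, 1 ≤ n → (1 - q) (stdVec n) = stdVec n := by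
      intro n hn
      rw [hq, ← coordProj_Ici_one]
      exact coordProj_stdVec (by simpa using hn)
    have hpc : ∀ (n : ℕ) (v : EllTwo), 1 ≤ n → (1 - q) v n = v n := by
      intro n v hn
      rw [hq, ← coordProj_Ici_one, coordProj_apply, if_pos (by simpa using hn)]
    -- The shift to `n - 1` is needed because row `n` itself must lie in the tail: `n ∈ (n - 1, ∞)`.
    have hb := ((hcorner.comp (tendsto_sub_atTop_nat 1)).const_mul ‖U'‖).mul
      (hE.norm.mul_const (‖U'‖ * ‖L'‖))
    rw [mul_zero, zero_mul] at hb
    refine squeeze_zero_norm' ?_ hb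
    filter_upwards [eventually_ge_atTop 1] with n hn
    have hmain : X n (stdVec n) n = S n (stdVec n) n -
        S n (q (E n (q (S n (stdVec n))))) n := by
      change ((1 - q) (S n ((1 - q) (stdVec n))) -
        (1 - q) (S n (q (E n (q (S n ((1 - q) (stdVec n)))))))) n = _
      rw [hpn n hn, lp.coeFn_sub, Pi.sub_apply, hpc n _ hn, hpc n _ hn]
    have hfirst : S n (stdVec n) n = U' (stdVec n) n * L' (stdVec n) n := by
      rw [hrowS, hr, coordProj_stdVec Set.self_mem_Iic]
    rw [hmain, hfirst, sub_sub_cancel_left, norm_neg, hrowS, norm_mul]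
    set v := E n (q (S n (stdVec n))) with hv
    have hrqv : r n (q v) = q v := congrArg (fun T : EllTwo →L[ℂ] EllTwo => T v) (hrq n)
    have htail : L' (q v) n = ((1 - r (n - 1)) * L' * q) v n := by
      change _ = (1 - r (n - 1)) (L' (q v)) n
      rw [hr, ← coordProj_Ioi, coordProj_apply, if_pos]
      rw [Set.mem_Ioi]
      omega
    have hvn : ‖v‖ ≤ ‖E n‖ * (‖U'‖ * ‖L'‖) := by
      refine (ContinuousLinearMap.le_opNorm _ _).trans ?_
      gcongr
      refine (norm_coordProj_apply_le _ _).trans ((ContinuousLinearMap.le_opNorm _ _).trans ?_)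
      rw [norm_stdVec, mul_one]
      exact hSn n
    rw [hrqv, htail]
    refine le_trans ?_ (mul_assoc _ _ _).ge
    refine mul_le_mul (norm_apply_stdVec_le _ _ _) ?_ (norm_nonneg _) (norm_nonneg _)
    refine (norm_coord_le _ _).trans ((ContinuousLinearMap.le_opNorm _ _).trans ?_)
    exact mul_le_mul_of_nonneg_left hvn (norm_nonneg _)

end

/-! ### The ratio of determinants -/

theorem corollary1 (a aLp aLm aRm aRp : StarSymbol)
    (h : IsWienerHopfStarFactorization a aLp aLm aRm aRp) :
    (∀ᶠ n : ℕ in atTop, (starToeplitz (n - 1) a).det * (diagCoef aLp n * diagCoef aLm n) ≠ 0) ∧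
    Tendsto
      (fun n : ℕ => (starToeplitz n a).det /
        ((starToeplitz (n - 1) a).det * (diagCoef aLp n * diagCoef aLm n)))
      atTop (𝓝 1) := by
  obtain ⟨L, hL, L', hL', hLa, hLL, hLL'⟩ := h.log_Lp.exists_inverse
    (isClosed_invariantSubalgebra _) fun A hA => hA.mem_lowerTriangular h.plus_L
  obtain ⟨U, hU, U', hU', hUa, hUU, hUU'⟩ := h.log_Lm.exists_inverse
    (isClosed_invariantSubalgebra _) fun A hA => hA.mem_upperTriangular h.minus_L
  obtain ⟨u, hu, u', hu', hua, huu, huu'⟩ := h.log_Rm.exists_inverse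
    (isClosed_invariantSubalgebra _) fun A hA => hA.mem_upperTriangular h.minus_R
  obtain ⟨l, hl, l', hl', hla, hll, hll'⟩ := h.log_Rp.exists_inverse
    (isClosed_invariantSubalgebra _) fun A hA => hA.mem_lowerTriangular h.plus_R
  have hA : IsStarLaurentOp a (L * U) := fun j k =>
    (hLa.mul h.mem_Lp h.mem_Lm hUa j k).trans (h.left_eq j k).symm
  have hA' : IsStarLaurentOp a (u * l) := fun j k =>
    (hua.mul h.mem_Rm h.mem_Rp hla j k).trans (h.right_eq j k).symm
  have heq : L * U = u * l := ext_stdVec fun j k => (hA j k).trans (hA' j k).symm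
  obtain ⟨X, hX, hlim⟩ := exists_compression_inverse h.mem_Lp hLa hL hU' hLL hLL' hUU hUU'
    hl hl' hu hu' hll hll' huu huu' heq
  have hdL : ∀ n : ℤ, diagCoef aLp n = L (stdVec n) n := fun n => by
    refine Eq.trans ?_ (hLa n n).symm
    rw [diagCoef, starLaurent, two_mul, sub_self]
  have hdU : ∀ n : ℤ, diagCoef aLm n = U (stdVec n) n := fun n => by
    refine Eq.trans ?_ (hUa n n).symm
    rw [diagCoef, starLaurent, two_mul, sub_self]
  have hone : ∀ n : ℤ, (1 : EllTwo →L[ℂ] EllTwo) (stdVec n) n = 1 := fun n => by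
    simp [stdVec_apply]
  have hL1 : ∀ n : ℤ, L' (stdVec n) n * L (stdVec n) n = 1 := fun n => by
    rw [← diag_mul_lowerTriangular hL' hL, hLL', hone]
  have hU1 : ∀ n : ℤ, U' (stdVec n) n * U (stdVec n) n = 1 := fun n => by
    rw [← diag_mul_upperTriangular hU' hU, hUU', hone]
  have hx : Tendsto (fun n : ℕ => X n (stdVec n) n * (diagCoef aLp n * diagCoef aLm n))
      atTop (𝓝 1) := by
    rw [tendsto_iff_norm_sub_tendsto_zero]
    have hb := hlim.norm.mul_const (‖L‖ * ‖U‖)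
    rw [norm_zero, zero_mul] at hb
    refine squeeze_zero (fun _ => norm_nonneg _) (fun n => ?_) hb
    have : X n (stdVec n) n * (diagCoef aLp n * diagCoef aLm n) - 1 =
        (X n (stdVec n) n - U' (stdVec n) n * L' (stdVec n) n) *
          (L (stdVec n) n * U (stdVec n) n) := by
      rw [hdL, hdU]
      linear_combination (U' (stdVec n) n * U (stdVec n) n) * hL1 n + hU1 n
    rw [this, norm_mul, norm_mul]
    gcongr <;> exact norm_apply_stdVec_le _ _ _
  -- The inverse section shows `det T_n ≠ 0`, and Cramer's rule identifies the ratio; `n ≥ 1` makes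
  -- the truncated `n - 1` genuine.
  have hdet : ∀ᶠ n : ℕ in atTop, (starToeplitz n a).det ≠ 0 ∧
      (starToeplitz (n - 1) a).det = (starToeplitz n a).det * X n (stdVec n) n := by
    filter_upwards [hX, eventually_ge_atTop 1] with n hn hn1
    obtain ⟨m, rfl⟩ := Nat.exists_eq_add_of_le' hn1
    rw [← hA.compression_eq, ← hA.compression_eq, Nat.add_sub_cancel]
    refine ⟨fun h0 => ?_, ?_⟩
    · have := congrArg Matrix.det hn
      rw [Matrix.det_mul, h0, zero_mul, Matrix.det_one] at this
      exact zero_ne_one this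
    · rw [det_compression_of_mul_eq_one hn]
      push_cast
      rfl
  have hne : ∀ᶠ n : ℕ in atTop, X n (stdVec n) n * (diagCoef aLp n * diagCoef aLm n) ≠ 0 :=
    hx.eventually_ne one_ne_zero
  constructor
  · filter_upwards [hdet, hne] with n ⟨h1, h2⟩ h3
    rw [h2, mul_assoc]
    exact mul_ne_zero h1 h3
  · have hinv := hx.inv₀ one_ne_zero
    rw [inv_one] at hinv
    refine hinv.congr' ?_
    filter_upwards [hdet, hne] with n ⟨h1, h2⟩ h3
    rw [h2, mul_assoc, ← div_div, div_self h1, one_div]
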